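/- For a $\mathbb C$-algebra $D$ and an element $\nabla\in D$ put $D(n)=\{P\in D : [\nabla,P]=nP\}$ for $n\in\mathbb Z$. We say that $D$ is graded by $\nabla$ if $D=\bigoplus_{n\in\mathbb Z}D(n)$; then $D^-=\bigoplus_{n<0}D(n)$ and $D^0=D(0)$. For a $D$-module $N$ put $\mathrm{Ann}_{D^-}(N)=\{m\in N : Pm=0 \text{ for all } P\in D^-\}$; it is a $D^0$-submodule of $N$. **Theorem 4.1.** Let $D_1$ be a $\mathbb C$-algebra graded by $\nabla_1\in D_1$, and let $D_2\subset D_1$ be a subalgebra graded by $\nabla_2\in D_2$, such that $D_2(n)\subset D_1(n)$ for all $n\in\mathbb Z$. Let $M$ be a $D_1$-module which is semisimple as a $D_1$-module, as a $D_2$-module and as a $\mathbb C[\nabla_2]$-module, and which satisfies $M=D_2\cdot\mathrm{Ann}_{D_2^-}(M)$. For a $D_1$-submodule $N$ of $M$ put $J_+(N)=D_2\cdot\mathrm{Ann}_{D_1^-}(N)$. Then, for every $D_1$-submodule $N$ of $M$: 1. If $\mathrm{Ann}_{D_1^-}(N)$, regarded as a $D_2^0$-module by restriction, is simple, then $J_+(N)$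 is a simple $D_2$-module. The hypothesis holds in particular if $\dim_{\mathbb C}\mathrm{Ann}_{D_1^-}(N)=1$. 2. $\mathrm{Ann}_{D_1^-}(N)=\mathrm{Ann}_{D_2^-}(J_+(N))$ as $D_2^0$-submodules of $M$. -/

import Mathlib

namespace MLS

section Graded

variable {D : Type*} [Ring D] [Algebra ℂ D]

/-- The eigenspace `D(n) = {P | [E, P] = n P}` of the adjoint action of `E` on `D`. -/
def homogeneous (E : D) (n : ℤ) : Submodule ℂ D where
  carrier := {P | E * P - P * E = (n : ℂ) • P}
  add_mem' := by
    intro P Q hP hQ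
    simp only [Set.mem_ofPred_eq] at hP hQ ⊢
    rw [smul_add, ← hP, ← hQ]
    noncomm_ring
  zero_mem' := by simp
  smul_mem' := by
    intro c P hP
    simp only [Set.mem_ofPred_eq] at hP ⊢
    rw [mul_smul_comm, smul_mul_assoc, ← smul_sub, hP, smul_comm]

theorem mem_homogeneous {E : D} {n : ℤ} {P : D} :
    P ∈ homogeneous E n ↔ E * P - P * E = (n : ℂ) • P := Iff.rfl

/-- The adjoint action of `E` on `D` is semisimple with integral eigenvalues, so that
`D` is the direct sum of the `D(n)`, `n ∈ ℤ`. -/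
def IsGradingElement (E : D) : Prop :=
  DirectSum.IsInternal (homogeneous E)

/-- The strictly negative part `D⁻ = ⨁_{n < 0} D(n)`. -/
def negPart (E : D) : Submodule ℂ D :=
  ⨆ n : ℤ, ⨆ _ : n < 0, homogeneous E n

theorem homogeneous_mul {E : D} {m n : ℤ} {P Q : D} (hP : P ∈ homogeneous E m)
    (hQ : Q ∈ homogeneous E n) : P * Q ∈ homogeneous E (m + n) := by
  rw [mem_homogeneous] at hP hQ ⊢
  have h : E * (P * Q) - P * Q * E = (E * P - P * E) * Q + P * (E * Q - Q * E) := by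
    noncomm_ring
  rw [h, hP, hQ, smul_mul_assoc, mul_smul_comm, ← add_smul]
  push_cast
  rfl

/-- The degree zero part `D⁰ = D(0)`, a subalgebra of `D`. -/
def zeroPart (E : D) : Subalgebra ℂ D where
  carrier := homogeneous E 0
  mul_mem' := fun {P Q} hP hQ => by
    have h := homogeneous_mul hP hQ
    rwa [add_zero] at h
  add_mem' := fun {P Q} hP hQ => (homogeneous E 0).add_mem hP hQ
  algebraMap_mem' := fun c => by
    rw [SetLike.mem_coe, mem_homogeneous, Algebra.commutes]
    simp

theorem mem_zeroPart {E : D} {P : D} : P ∈ zeroPart E ↔ P ∈ homogeneous E 0 := Iff.rfl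

theorem negPart_mul_zeroPart {E : D} {P Q : D} (hQ : Q ∈ negPart E) (hP : P ∈ zeroPart E) :
    Q * P ∈ negPart E := by
  have h : negPart E ≤ (negPart E).comap (LinearMap.mulRight ℂ P) := by
    refine iSup₂_le fun n hn R hR => ?_
    have h1 := homogeneous_mul hR (mem_zeroPart.1 hP)
    rw [add_zero] at h1
    exact (le_iSup₂_of_le (f := fun (n : ℤ) (_ : n < 0) => homogeneous E n) n hn le_rfl) h1
  exact h hQ

variable {M : Type*} [AddCommGroup M] [Module D M]

/-- `Ann_{D⁻}(N) = {m ∈ N | D⁻ m = 0}` for a `D`-submodule `N` of `M`, as a `D⁰`-module. -/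
def ann (E : D) (N : Submodule D M) : Submodule (zeroPart E) M where
  carrier := {m | m ∈ N ∧ ∀ P ∈ negPart E, P • m = 0}
  add_mem' := by
    rintro a b ⟨ha, ha'⟩ ⟨hb, hb'⟩
    exact ⟨N.add_mem ha hb, fun P hP => by rw [smul_add, ha' P hP, hb' P hP, add_zero]⟩
  zero_mem' := ⟨N.zero_mem, fun P _ => smul_zero P⟩
  smul_mem' := by
    rintro ⟨P, hP⟩ a ⟨ha, ha'⟩
    refine ⟨N.smul_mem P ha, fun Q hQ => ?_⟩
    change Q • P • a = 0
    rw [smul_smul]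
    exact ha' _ (negPart_mul_zeroPart hQ hP)

end Graded

section Inclusion

variable {D₁ : Type*} [Ring D₁] [Algebra ℂ D₁]

/-- The inclusion of the subalgebra `D₂` in `D₁` is graded: `D₂(n) ⊆ D₁(n)` for all `n`, where
`D₁` and `D₂` are graded by the adjoint actions of `E₁ ∈ D₁` and `E₂ ∈ D₂`. -/
def IsGradedInclusion (D₂ : Subalgebra ℂ D₁) (E₁ : D₁) (E₂ : D₂) : Prop :=
  ∀ n : ℤ, ∀ P : D₂, P ∈ homogeneous E₂ n → (P : D₁) ∈ homogeneous E₁ n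

variable {M : Type*} [AddCommGroup M] [Module D₁ M]

/-- `Ann_{D₁⁻}(N)` regarded as a `D₂⁰`-module by restriction along `D₂⁰ ⊆ D₁⁰`. -/
def annRestrict {D₂ : Subalgebra ℂ D₁} {E₁ : D₁} {E₂ : D₂} (h : IsGradedInclusion D₂ E₁ E₂)
    (N : Submodule D₁ M) : Submodule (zeroPart E₂) M where
  carrier := ann E₁ N
  add_mem' := fun ha hb => (ann E₁ N).add_mem ha hb
  zero_mem' := (ann E₁ N).zero_mem
  smul_mem' := fun P _ ha => (ann E₁ N).smul_mem ⟨((P : D₂) : D₁), h 0 P P.2⟩ ha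

/-- `J₊(N) = D₂ · Ann_{D₁⁻}(N)`. -/
def Jplus (D₂ : Subalgebra ℂ D₁) (E₁ : D₁) (N : Submodule D₁ M) : Submodule D₂ M :=
  Submodule.span D₂ (ann E₁ N : Set M)

end Inclusion

end MLS

/-! Since `D₂⁻ ⊆ D₁⁻`, the space `A = Ann_{D₁⁻}(N)` is a `D₂⁰`-submodule killed by `D₂⁻`, so only `D
= D₂` matters from then on. Grading gives `D·A = A + D^{>0}·A`. The key point
(`eq_zero_of_mem_ann_of_mem_posSpan`) is that no nonzero vector killed by `D⁻` lies in
`D^{>0}·Ann_{D⁻}(M)`: after projection to a simple submodule, vectors killed by `D⁻` have a single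
weight `μ`, while positive degrees reach only `μ + 1, μ + 2, …`. Hence `Ann_{D⁻}(D·A) = A`. For
simplicity, a nonzero `W ≤ D·A` is generated by `Ann_{D⁻}(W)`, a nonzero `D⁰`-submodule of `A`; if
`A` is simple it is all of `A`, so `W = D·A`. -/

namespace MLS

open Module.End

/-! ### Diagonalizability of semisimple endomorphisms -/

section Eigenspaces

variable {K M : Type*} [Field K] [IsAlgClosed K] [AddCommGroup M] [Module K M]

/-- A semisimple endomorphism of an arbitrary (possibly infinite-dimensional) vector space over an
algebraically closed field is diagonalizable. -/
theorem iSup_eigenspace_eq_top_of_isSemisimple {f : Module.End K M} (hf : f.IsSemisimple) :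
    ⨆ μ : K, eigenspace f μ = ⊤ := by
  rw [eq_top_iff]
  have hss : IsSemisimpleModule (Polynomial K) (Module.AEval' f) := hf
  intro m _
  have hm : Module.AEval'.of f m ∈
      sSup {S : Submodule (Polynomial K) (Module.AEval' f) | IsSimpleModule (Polynomial K) S} := by
    rw [IsSemisimpleModule.sSup_simples_eq_top]
    exact Submodule.mem_top
  rw [sSup_eq_iSup', Submodule.iSup_eq_span] at hm
  refine Submodule.closure_induction
    (p := fun x _ => (Module.AEval'.of f).symm x ∈ ⨆ μ : K, eigenspace f μ) ?_ ?_ ?_ hm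
  · simp
  · intro x y _ _ hx hy
    rw [map_add]
    exact add_mem hx hy
  · intro p x hx
    obtain ⟨⟨S, hS⟩, hxS⟩ := Set.mem_iUnion.1 hx
    have : IsSimpleModule (Polynomial K) S := hS
    -- A simple `K[X]`-module is `K[X]/(q)` with `(q)` maximal; a root `a` of `q` forces `(q) = (X -
    -- a)`, so `f` acts on it as `a`.
    obtain ⟨I, hI, ⟨e⟩⟩ := isSimpleModule_iff_quot_maximal.1 this
    obtain ⟨q, rfl⟩ := (IsPrincipalIdealRing.principal I).principal
    have hq0 : q ≠ 0 := by
      rintro rfl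
      have h0 : Submodule.span (Polynomial K) {(0 : Polynomial K)} = ⊥ := by simp
      rw [h0] at hI
      exact Polynomial.not_isField K (Ring.isField_iff_maximal_bot.2 hI)
    have hqu : ¬ IsUnit q := fun h => hI.ne_top (Ideal.span_singleton_eq_top.2 h)
    obtain ⟨a, ha⟩ := IsAlgClosed.exists_root q
      (fun h => hqu (Polynomial.isUnit_iff_degree_eq_zero.2 h))
    have hle : Submodule.span (Polynomial K) {q} ≤ Ideal.span {Polynomial.X - Polynomial.C a} := by
      refine Ideal.span_singleton_le_span_singleton.2 (Polynomial.dvd_iff_isRoot.2 ha)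
    have hmem : Polynomial.X - Polynomial.C a ∈ Submodule.span (Polynomial K) {q} := by
      rw [hI.eq_of_le (fun h => (Polynomial.not_isUnit_X_sub_C a)
        (Ideal.span_singleton_eq_top.1 h)) hle]
      exact Ideal.mem_span_singleton_self _
    have hkill : ∀ y : S, (Polynomial.X - Polynomial.C a) • y = 0 := by
      intro y
      apply e.injective
      rw [map_smul, map_zero]
      obtain ⟨r, hr⟩ := Submodule.Quotient.mk_surjective _ (e y)
      rw [← hr, ← Submodule.Quotient.mk_smul, Submodule.Quotient.mk_eq_zero, smul_eq_mul]
      exact Ideal.mul_mem_right _ _ hmem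
    have h := congrArg (fun y : S => (Module.AEval'.of f).symm (y : Module.AEval' f))
      (hkill ⟨p • x, S.smul_mem p hxS⟩)
    refine Submodule.mem_iSup_of_mem a ?_
    rw [mem_eigenspace_iff]
    simp only [Submodule.coe_smul, Module.AEval.of_symm_smul, map_sub, Polynomial.aeval_X,
      Polynomial.aeval_C, ZeroMemClass.coe_zero, map_zero] at h
    rw [sub_smul, sub_eq_zero] at h
    rw [Module.AEval.of_symm_smul]
    simpa using h

/-- Semisimplicity passes to the restriction of `f` to `U`, which is therefore diagonalizable. -/
theorem le_iSup_inf_eigenspace {f : Module.End K M} (hf : f.IsSemisimple) {U : Submodule K M}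
    (hU : U ∈ f.invtSubmodule) : U ≤ ⨆ μ : K, U ⊓ eigenspace f μ := by
  have h := iSup_eigenspace_eq_top_of_isSemisimple (hf.restrict hU)
  have h2 := congrArg (Submodule.map U.subtype) h
  rw [Submodule.map_iSup, Submodule.map_subtype_top] at h2
  refine h2.ge.trans (iSup_mono fun μ => le_inf (Submodule.map_subtype_le _ _) ?_)
  exact eigenspace_restrict_le_eigenspace f hU μ

end Eigenspaces

theorem mem_of_isSimpleModule {D M : Type*} [Ring D] [AddCommGroup M] [Module D M] {V : Submodule D M} [IsSimpleModule D V] {v w : M} (hv : v ∈ V)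
    (hw : w ∈ V) (hv0 : v ≠ 0) : ∃ P : D, P • v = w := by
  obtain ⟨P, hP⟩ := IsSimpleModule.toSpanSingleton_surjective D
    (m := (⟨v, hv⟩ : V)) (by simpa using hv0) ⟨w, hw⟩
  exact ⟨P, by simpa using congrArg Subtype.val hP⟩

/-! ### Weights and vectors killed by `D⁻` -/

section Graded

variable {D : Type*} [Ring D] [Algebra ℂ D] {E : D}

theorem self_mem_zeroPart (E : D) : E ∈ zeroPart E := by
  rw [mem_zeroPart, mem_homogeneous]
  simp

theorem mem_negPart {n : ℤ} (hn : n < 0) {P : D} (hP : P ∈ homogeneous E n) : P ∈ negPart E :=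
  (le_iSup₂_of_le (f := fun (n : ℤ) (_ : n < 0) => homogeneous E n) n hn le_rfl) hP

variable {M : Type*} [AddCommGroup M] [Module D M]

theorem mem_ann {N : Submodule D M} {m : M} :
    m ∈ ann E N ↔ m ∈ N ∧ ∀ P ∈ negPart E, P • m = 0 := Iff.rfl

theorem ann_mono {N N' : Submodule D M} (h : N ≤ N') {m : M} (hm : m ∈ ann E N) :
    m ∈ ann E N' := ⟨h hm.1, hm.2⟩

theorem map_mem_ann (g : M →ₗ[D] M) {V N : Submodule D M} (hg : ∀ m, g m ∈ V) {m : M}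
    (hm : m ∈ ann E N) : g m ∈ ann E V :=
  ⟨hg m, fun P hP => by rw [← map_smul, hm.2 P hP, map_zero]⟩

/-- Generation by vectors killed by `D⁻` passes to submodules of a semisimple module. -/
theorem span_ann_eq [IsSemisimpleModule D M]
    (hgen : Submodule.span D (ann E (⊤ : Submodule D M) : Set M) = ⊤) (W : Submodule D M) :
    Submodule.span D (ann E W : Set M) = W := by
  refine le_antisymm (Submodule.span_le.2 fun m hm => hm.1) fun w hw => ?_
  obtain ⟨K, hK⟩ := exists_isCompl W
  let g : M →ₗ[D] M := W.projection K hK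
  have hgw : g w = w := Submodule.projection_apply_of_mem_left hK hw
  -- The projection onto `W` is `D`-linear, so it sends generators of `M` killed by `D⁻` to vectors
  -- of `W` killed by `D⁻`.
  have hle : Submodule.span D (ann E (⊤ : Submodule D M) : Set M) ≤
      (Submodule.span D (ann E W : Set M)).comap g :=
    Submodule.span_le.2 fun m hm => Submodule.subset_span
      (map_mem_ann g (Submodule.projection_apply_mem hK) hm)
  rw [hgen] at hle
  rw [← hgw]
  exact hle Submodule.mem_top

variable [Module ℂ M]

/-- To check a linear condition on `P • m` for all `P`, it suffices to take `P` homogeneous. -/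
theorem smul_mem_of_homogeneous (hE : IsGradingElement E) {W : Submodule ℂ M} {m : M}
    (h : ∀ n : ℤ, ∀ P ∈ homogeneous E n, P • m ∈ W) (P : D) : P • m ∈ W := by
  have hP : P ∈ ⨆ n, homogeneous E n := by
    rw [DirectSum.IsInternal.submodule_iSup_eq_top hE]
    exact Submodule.mem_top
  refine Submodule.iSup_induction _ (motive := fun P : D => P • m ∈ W) hP h ?_ ?_
  · simp
  · intro P Q hP hQ
    rw [add_smul]
    exact add_mem hP hQ

/-- `D^{>0} · A`, the linear span of the `P • a` with `P` homogeneous of positive degree. -/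
def posSpan (E : D) (A : Set M) : Submodule ℂ M :=
  Submodule.span ℂ {m | ∃ n : ℤ, 0 < n ∧ ∃ P ∈ homogeneous E n, ∃ a ∈ A, P • a = m}

theorem posSpan_mono {A B : Set M} (h : A ⊆ B) : posSpan E A ≤ posSpan E B :=
  Submodule.span_mono fun _ ⟨n, hn, P, hP, a, ha, e⟩ => ⟨n, hn, P, hP, a, h ha, e⟩

variable [IsScalarTower ℂ D M]

theorem smul_mem_eigenspace {n : ℤ} {P : D} (hP : P ∈ homogeneous E n) {μ : ℂ} {m : M}
    (hm : m ∈ eigenspace (Algebra.lsmul ℂ ℂ M E) μ) :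
    P • m ∈ eigenspace (Algebra.lsmul ℂ ℂ M E) (μ + n) := by
  rw [mem_eigenspace_iff] at hm ⊢
  change E • m = μ • m at hm
  change E • P • m = (μ + n : ℂ) • P • m
  rw [mem_homogeneous, sub_eq_iff_eq_add] at hP
  rw [smul_smul, hP, add_smul, mul_smul, hm, smul_assoc, smul_comm P μ m, add_smul, add_comm]

/-- `D` maps a vector of weight `μ` killed by `D⁻` to vectors of weights in `μ + ℕ`. -/
theorem smul_mem_iSup_eigenspace (hE : IsGradingElement E) {N : Submodule D M} {μ : ℂ} {m : M}
    (hm : m ∈ ann E N) (hμ : m ∈ eigenspace (Algebra.lsmul ℂ ℂ M E) μ) (P : D) :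
    P • m ∈ ⨆ k : ℕ, eigenspace (Algebra.lsmul ℂ ℂ M E) (μ + k) := by
  refine smul_mem_of_homogeneous hE (fun n P hP => ?_) P
  rcases lt_or_ge n 0 with hn | hn
  · rw [hm.2 P (mem_negPart hn hP)]
    exact zero_mem _
  · lift n to ℕ using hn
    exact Submodule.mem_iSup_of_mem n (by simpa using smul_mem_eigenspace hP hμ)

theorem exists_eq_of_mem_iSup_eigenspace {ι : Type*} (f : Module.End ℂ M) (g : ι → ℂ) {μ : ℂ}
    {m : M} (hm0 : m ≠ 0) (hm : m ∈ eigenspace f μ) (h : m ∈ ⨆ i, eigenspace f (g i)) :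
    ∃ i, μ = g i := by
  by_contra! hne
  refine hm0 (Submodule.disjoint_def.1 (f.eigenspaces_iSupIndep μ) m hm ?_)
  refine (iSup_le fun i => ?_ : (⨆ i, eigenspace f (g i)) ≤ _) h
  exact le_iSup₂_of_le (g i) (hne i).symm le_rfl

/-- In a simple module on which `E` is semisimple, the vectors killed by `D⁻` have a single
weight. -/
theorem exists_ann_le_eigenspace (hE : IsGradingElement E)
    (hss : (Algebra.lsmul ℂ ℂ M E).IsSemisimple) (V : Submodule D M) [IsSimpleModule D V] :
    ∃ μ : ℂ, ∀ m ∈ ann E V, m ∈ eigenspace (Algebra.lsmul ℂ ℂ M E) μ := by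
  set f := Algebra.lsmul ℂ ℂ M E
  let U : Submodule ℂ M := (ann E V).restrictScalars ℂ
  have hU : U ∈ f.invtSubmodule := fun m hm =>
    (ann E V).smul_mem (⟨E, self_mem_zeroPart E⟩ : zeroPart E) hm
  have hdec := le_iSup_inf_eigenspace hss hU
  by_cases hex : ∃ μ, U ⊓ eigenspace f μ ≠ ⊥
  · obtain ⟨μ, hμ⟩ := hex
    obtain ⟨v, ⟨hvU, hvμ⟩, hv0⟩ := Submodule.exists_mem_ne_zero_of_ne_bot hμ
    refine ⟨μ, fun m hm => ?_⟩
    have hle : ⨆ ν, U ⊓ eigenspace f ν ≤ eigenspace f μ := by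
      refine iSup_le fun ν u hu => ?_
      rcases eq_or_ne u 0 with rfl | hu0
      · exact zero_mem _
      obtain ⟨huU, huν⟩ := hu
      have hvA : v ∈ ann E V := hvU
      have huA : u ∈ ann E V := huU
      -- Each of `u`, `v` generates `V`, so `ν - μ` and `μ - ν` are both natural numbers, hence
      -- zero.
      obtain ⟨P, hP⟩ := mem_of_isSimpleModule hvA.1 huA.1 hv0
      obtain ⟨Q, hQ⟩ := mem_of_isSimpleModule huA.1 hvA.1 hu0
      obtain ⟨k, hk⟩ := exists_eq_of_mem_iSup_eigenspace f _ hu0 huν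
        (hP ▸ smul_mem_iSup_eigenspace hE hvA hvμ P)
      obtain ⟨l, hl⟩ := exists_eq_of_mem_iSup_eigenspace f _ hv0 hvμ
        (hQ ▸ smul_mem_iSup_eigenspace hE huA huν Q)
      have hkl : ((k + l : ℕ) : ℂ) = 0 := by
        push_cast
        linear_combination -hk - hl
      have hk0 : k = 0 := by
        have := Nat.cast_eq_zero.1 hkl
        omega
      rw [hk0, Nat.cast_zero, add_zero] at hk
      exact hk ▸ huν
    exact hle (hdec hm)
  · push Not at hex
    -- Without weights `Ann_{D⁻}(V)` vanishes, and the value `0` is arbitrary.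
    refine ⟨0, fun m hm => ?_⟩
    have h0 := hdec hm
    simp only [hex, iSup_bot] at h0
    rw [(Submodule.mem_bot ℂ).1 h0]
    exact zero_mem _

/-- `D · A = A + D^{>0} · A` when `A` is a `D⁰`-submodule killed by `D⁻`. -/
theorem exists_sub_mem_posSpan (hE : IsGradingElement E) (A : Submodule (zeroPart E) M)
    (hA : ∀ a ∈ A, ∀ P ∈ negPart E, P • a = 0) {m : M}
    (hm : m ∈ Submodule.span D (A : Set M)) : ∃ a ∈ A, m - a ∈ posSpan E (A : Set M) := by
  suffices h : m ∈ A.restrictScalars ℂ ⊔ posSpan E (A : Set M) by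
    obtain ⟨a, ha, b, hb, rfl⟩ := Submodule.mem_sup.1 h
    exact ⟨a, ha, by simpa using hb⟩
  refine Submodule.closure_induction
    (p := fun m _ => m ∈ A.restrictScalars ℂ ⊔ posSpan E (A : Set M)) (zero_mem _)
    (fun _ _ _ _ => add_mem) (fun P a ha => ?_) hm
  refine smul_mem_of_homogeneous hE (fun n P hP => ?_) P
  rcases lt_trichotomy n 0 with hn | rfl | hn
  · rw [hA a ha P (mem_negPart hn hP)]
    exact zero_mem _
  · exact Submodule.mem_sup_left (A.smul_mem (⟨P, hP⟩ : zeroPart E) ha)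
  · exact Submodule.mem_sup_right (Submodule.subset_span ⟨n, hn, P, hP, a, ha, rfl⟩)

/-- In a semisimple module on which `E` is semisimple, no nonzero vector killed by `D⁻` is
generated in positive degree by vectors killed by `D⁻`. -/
theorem eq_zero_of_mem_ann_of_mem_posSpan (hE : IsGradingElement E) [IsSemisimpleModule D M]
    (hss : (Algebra.lsmul ℂ ℂ M E).IsSemisimple) {N N' : Submodule D M} {m : M}
    (hm : m ∈ ann E N) (hpos : m ∈ posSpan E (ann E N' : Set M)) : m = 0 := by
  -- The radical of a semisimple module is zero, so it is enough that `m` lies in every maximal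
  -- submodule `K`, i.e. that its projection to a simple complement `V` vanishes.
  suffices h : m ∈ Module.jacobson D M by
    rwa [IsSemisimpleModule.jacobson_eq_bot, Submodule.mem_bot] at h
  rw [Module.jacobson, Submodule.mem_sInf]
  intro K hK
  obtain ⟨V, hV⟩ := exists_isCompl K
  have : IsSimpleModule D (M ⧸ K) := isSimpleModule_iff_isCoatom.2 hK
  have : IsSimpleModule D V := .congr (Submodule.quotientEquivOfIsCompl K V hV).symm
  let g : M →ₗ[D] M := V.projection K hV.symm
  have hg : ∀ x, g x ∈ V := Submodule.projection_apply_mem hV.symm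
  obtain ⟨μ, hμ⟩ := exists_ann_le_eigenspace hE hss V
  have hgm : g m ∈ ⨆ k : ℕ, eigenspace (Algebra.lsmul ℂ ℂ M E) (μ + ((k + 1 : ℕ) : ℂ)) := by
    have hle : posSpan E (ann E N' : Set M) ≤
        (⨆ k : ℕ, eigenspace (Algebra.lsmul ℂ ℂ M E) (μ + ((k + 1 : ℕ) : ℂ))).comap
          (g.restrictScalars ℂ) := by
      refine Submodule.span_le.2 ?_
      rintro _ ⟨n, hn, P, hP, a, ha, rfl⟩
      obtain ⟨k, rfl⟩ : ∃ k : ℕ, n = ((k + 1 : ℕ) : ℤ) := ⟨(n - 1).toNat, by omega⟩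
      rw [SetLike.mem_coe, Submodule.mem_comap, LinearMap.restrictScalars_apply, map_smul]
      have := smul_mem_eigenspace hP (hμ _ (map_mem_ann g hg ha))
      exact Submodule.mem_iSup_of_mem k (by simpa using this)
    exact hle hpos
  have hg0 : g m = 0 := by
    by_contra hne
    obtain ⟨k, hk⟩ := exists_eq_of_mem_iSup_eigenspace _ _ hne
      (hμ _ (map_mem_ann g hg hm)) hgm
    have : ((k + 1 : ℕ) : ℂ) = 0 := by linear_combination -hk
    exact Nat.succ_ne_zero k (Nat.cast_eq_zero.1 this)
  have hg0' : V.projectionOnto K hV.symm m = 0 := Subtype.ext hg0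
  exact (Submodule.projectionOnto_apply_eq_zero_iff hV.symm).1 hg0'

/-- `Ann_{D⁻}(D · A) = A` for a `D⁰`-submodule `A` killed by `D⁻`. -/
theorem mem_of_mem_ann_span (hE : IsGradingElement E) [IsSemisimpleModule D M]
    (hss : (Algebra.lsmul ℂ ℂ M E).IsSemisimple) (A : Submodule (zeroPart E) M)
    (hA : ∀ a ∈ A, ∀ P ∈ negPart E, P • a = 0) {m : M}
    (hm : m ∈ ann E (Submodule.span D (A : Set M))) : m ∈ A := by
  obtain ⟨a, ha, hpos⟩ := exists_sub_mem_posSpan hE A hA hm.1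
  -- The difference `m - a` is killed by `D⁻` and generated in positive degree, hence zero.
  have hsub : m - a ∈ ann E (⊤ : Submodule D M) :=
    ⟨Submodule.mem_top, fun P hP => by rw [smul_sub, hm.2 P hP, hA a ha P hP, sub_zero]⟩
  have h0 := eq_zero_of_mem_ann_of_mem_posSpan hE hss hsub
    (posSpan_mono (B := (ann E (⊤ : Submodule D M) : Set M))
      (fun x hx => ⟨Submodule.mem_top, hA x hx⟩) hpos)
  rwa [sub_eq_zero.1 h0]

/-- If `A` is a simple `D⁰`-submodule killed by `D⁻`, then `D · A` is simple. -/
theorem isSimpleModule_span (hE : IsGradingElement E) [IsSemisimpleModule D M]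
    (hss : (Algebra.lsmul ℂ ℂ M E).IsSemisimple)
    (hgen : Submodule.span D (ann E (⊤ : Submodule D M) : Set M) = ⊤)
    (A : Submodule (zeroPart E) M) (hA : ∀ a ∈ A, ∀ P ∈ negPart E, P • a = 0)
    (hs : IsSimpleModule (zeroPart E) A) :
    IsSimpleModule D (Submodule.span D (A : Set M)) := by
  rw [isSimpleModule_iff_isAtom] at hs ⊢
  rw [isAtom_iff_le_of_ge] at hs ⊢
  refine ⟨fun h => hs.1 ?_, fun W hW0 hW => ?_⟩
  · rw [Submodule.span_eq_bot] at h
    exact (Submodule.eq_bot_iff A).2 h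
  · have hWA : ann E W ≤ A := fun m hm => mem_of_mem_ann_span hE hss A hA (ann_mono hW hm)
    have hne : ann E W ≠ ⊥ := fun h => hW0 <| by
      rw [← span_ann_eq hgen W, h]
      simp
    exact Submodule.span_le.2 fun a ha => (hs.2 _ hne hWA ha).1

end Graded

/-! ### Passage from `D₁` to `D₂` -/

section Inclusion

variable {D₁ : Type*} [Ring D₁] [Algebra ℂ D₁] {D₂ : Subalgebra ℂ D₁} {E₁ : D₁} {E₂ : D₂}

theorem coe_mem_negPart (h : IsGradedInclusion D₂ E₁ E₂) {P : D₂} (hP : P ∈ negPart E₂) :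
    (P : D₁) ∈ negPart E₁ := by
  have hle : negPart E₂ ≤ (negPart E₁).comap D₂.val.toLinearMap :=
    iSup₂_le fun n hn Q hQ => mem_negPart hn (h n Q hQ)
  exact hle hP

theorem smul_eq_zero_of_mem_annRestrict {M : Type*} [AddCommGroup M] [Module D₁ M]
    (h : IsGradedInclusion D₂ E₁ E₂) {N : Submodule D₁ M} {a : M} (ha : a ∈ annRestrict h N)
    {P : D₂} (hP : P ∈ negPart E₂) : P • a = 0 :=
  ha.2 P (coe_mem_negPart h hP)

end Inclusion

end MLS

theorem theorem4p1 {D₁ : Type*} [Ring D₁] [Algebra ℂ D₁] (D₂ : Subalgebra ℂ D₁)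
    (E₁ : D₁) (E₂ : D₂)
    (hE₁ : MLS.IsGradingElement E₁) (hE₂ : MLS.IsGradingElement E₂)
    (hincl : MLS.IsGradedInclusion D₂ E₁ E₂)
    {M : Type*} [AddCommGroup M] [Module ℂ M] [Module D₁ M] [IsScalarTower ℂ D₁ M]
    (hM₁ : IsSemisimpleModule D₁ M) (hM₂ : IsSemisimpleModule D₂ M)
    (hME₂ : (Algebra.lsmul ℂ ℂ M E₂).IsSemisimple)
    (hgen : Submodule.span D₂ (MLS.ann E₂ (⊤ : Submodule D₂ M) : Set M) = ⊤)
    (N : Submodule D₁ M) :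
    (IsSimpleModule (MLS.zeroPart E₂) (MLS.annRestrict hincl N) →
      IsSimpleModule D₂ (MLS.Jplus D₂ E₁ N)) ∧
    (Module.finrank ℂ (MLS.annRestrict hincl N) = 1 →
      IsSimpleModule (MLS.zeroPart E₂) (MLS.annRestrict hincl N)) ∧
    MLS.annRestrict hincl N = MLS.ann E₂ (MLS.Jplus D₂ E₁ N) := by
  have hA : ∀ a ∈ MLS.annRestrict hincl N, ∀ P ∈ MLS.negPart E₂, P • a = 0 :=
    fun a ha P hP => MLS.smul_eq_zero_of_mem_annRestrict hincl ha hP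
  refine ⟨MLS.isSimpleModule_span hE₂ hME₂ hgen _ hA,
    fun h => (isSimpleModule_iff ..).2 (is_simple_module_of_finrank_eq_one (K := ℂ) (A := MLS.zeroPart E₂)
      (V := MLS.annRestrict hincl N) h), ?_⟩
  exact le_antisymm (fun a ha => ⟨Submodule.subset_span ha, hA a ha⟩)
    fun m hm => MLS.mem_of_mem_ann_span hE₂ hME₂ _ hA hm
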